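/- **Setting.** Let $\alpha$ be any ordinal and $\Sigma$ a finite alphabet with a distinguished blank symbol $\diamond$. The blank of $\Sigma^r$ is $(\diamond,\dots,\diamond)$. An $(\alpha)$-word over $\Sigma$ is a map $w\colon\alpha\to\Sigma$ with finite support $\{\beta<\alpha : w(\beta)\neq\diamond\}$. An ordinal automaton $\mathcal A=(Q,\Sigma,I,F,\Delta)$ has a finite state set $Q$, sets $I,F\subseteq Q$ of initial and final states, and a transition relation $\Delta\subseteq (Q\times\Sigma\times Q)\cup(2^Q\times Q)$. It accepts an $(\alpha)$-word $w$ if there is a map $r\colon\alpha+1\to Q$ with $r(0)\in I$, $r(\alpha)\in F$, $(r(\beta),w(\beta),r(\beta+1))\in\Delta$ for all $\beta<\alpha$, and $(\lim_\beta r,\,r(\beta))\in\Delta$ for all limit ordinals $\beta\le\alpha$, where $\lim_\beta r=\{q : \forall \beta'<\beta\ \exists \beta''\ (\beta'<\beta''<\beta,\ r(\beta'')=q)\}$. An automaton $\mathcal A$ over $\Sigma^{r}$ recognises the $r$-ary relation $R_{\mathcal A}$ of all tuples $(w_1,\dots,w_r)$ of $(\alpha)$-words over $\Sigma$ such that $\mathcal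 A$ accepts $\beta\mapsto(w_1(\beta),\dots,w_r(\beta))$. Let $A$ be the set of $(\alpha)$-words over $\Sigma$ accepted by some ordinal automaton (for instance, the set of all $(\alpha)$-words over $\Sigma$). Let $\Phi$ be a finite set of ordinal automata, each $\mathcal A\in\Phi$ recognising a $(1+p)$-ary relation of $(\alpha)$-words over $\Sigma$ for some $p\in\mathbb N$ depending on $\mathcal A$. Let $\mathcal F$ be a family of subsets of $A$. For $E\subseteq A$ and $a,a'\in A$ write $a\sim^\Phi_E a'$ if $(a,e_1,\dots,e_p)\in R_{\mathcal A}\Leftrightarrow(a',e_1,\dots,e_p)\in R_{\mathcal A}$ for all $\mathcal A\in\Phi$ and all $e_1,\dots,e_p\in E$. A set $G\subseteq A$ is $E$-$\Phi$-free if $a\not\sim^\Phi_E a'$ for all distinct $a,a'\in G$; it is maximal $E$-$\Phi$-free if moreover no strict superset of $G$ in $A$ is $E$-$\Phi$-free. Put $$\nu^\Phi_{\mathcal F}(E)=\min_{G\text{ maximal }E\text{-}\Phi\text{-free}}\ \max\{|F| : F\in\mathcal F,\ F\subseteq G\},\qquad \nu^\Phi_{\mathcal F}(n)=\inf\{\nu^\Phi_{\mathcal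 F}(E) : E\in\mathcal F,\ |E|=n\}\in\mathbb N\cup\{\infty\}$$ with $\inf\emptyset=\infty$. **Theorem.** Suppose that $\emptyset\in\mathcal F$ and that $\mathcal F$ is infinite in the sense that it contains finite sets of arbitrarily large cardinality. Then for every real number $c>1$ there are infinitely many $n\in\mathbb N$ with $\nu^\Phi_{\mathcal F}(n)\le n^c$. -/

import Mathlib

universe u v

namespace OrdinalAutomatic

/-- Every alphabet carries a distinguished blank symbol `◇`. -/
class Blank (S : Type v) where
  /-- the blank symbol -/
  blank : S

/-- The blank symbol of the alphabet `S ^ r` is `(◇, …, ◇)`. -/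
instance instBlankTuple (S : Type v) [Blank S] (r : ℕ) : Blank (Fin r → S) where
  blank := fun _ => Blank.blank

/-- The `(α)`-words over `S`: maps `w : α → S` (an ordinal being the set of smaller ordinals) whose
support `{β < α | w β ≠ ◇}` is finite. -/
def FinWord (S : Type v) [Blank S] (α : Ordinal.{u}) : Type (max (u + 1) v) :=
  {w : Set.Iio α → S // {β | w β ≠ Blank.blank}.Finite}

/-- The convolution of an `r`-tuple of `(α)`-words over `S`, an `(α)`-word over `S ^ r`. -/
def conv {S : Type v} [Blank S] {α : Ordinal.{u}} {r : ℕ} (w : Fin r → FinWord S α) :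
    FinWord (Fin r → S) α :=
  ⟨fun β i => (w i).1 β, by
    refine (Set.finite_iUnion fun i => (w i).2).subset fun β hβ => ?_
    obtain ⟨i, hi⟩ := Function.ne_iff.mp hβ
    exact Set.mem_iUnion.mpr ⟨i, hi⟩⟩

/-- An ordinal automaton over the alphabet `S`. Its transition relation, a subset of
`(Q × S × Q) ∪ (2 ^ Q × Q)`, is given by its two parts. -/
structure OrdinalAutomaton (S : Type v) where
  /-- the states -/
  Q : Type
  /-- there are finitely many states -/
  finite_states : Finite Q
  /-- the initial states -/
  start : Set Q
  /-- the final states -/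
  accept : Set Q
  /-- the successor transitions -/
  succTrans : Set (Q × S × Q)
  /-- the limit transitions -/
  limTrans : Set (Set Q × Q)

/-- The set of images of `r` that are cofinal in `β`. -/
def cofinalImages {Q : Type} (r : Ordinal.{u} → Q) (β : Ordinal.{u}) : Set Q :=
  {q | ∀ β' < β, ∃ β'', β' < β'' ∧ β'' < β ∧ r β'' = q}

/-- `r` is a run of `A` on the `(α)`-word `w`. A run is a map on `α + 1 = {β | β ≤ α}`; only the
values of `r` on this set are used. -/
structure IsRun {S : Type v} [Blank S] {α : Ordinal.{u}} (A : OrdinalAutomaton S)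
    (w : FinWord S α) (r : Ordinal.{u} → A.Q) : Prop where
  succ_mem : ∀ (β : Ordinal.{u}) (hβ : β < α), (r β, w.1 ⟨β, hβ⟩, r (β + 1)) ∈ A.succTrans
  lim_mem : ∀ β ≤ α, Order.IsSuccLimit β → (cofinalImages r β, r β) ∈ A.limTrans

/-- The `(α)`-language of `A`: the `(α)`-words that admit an accepting run. -/
def language {S : Type v} [Blank S] (α : Ordinal.{u}) (A : OrdinalAutomaton S) :
    Set (FinWord S α) :=
  {w | ∃ r : Ordinal.{u} → A.Q, IsRun A w r ∧ r 0 ∈ A.start ∧ r α ∈ A.accept}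

/-- The `r`-ary relation on `(α)`-words over `S` recognised by an `r`-dimensional automaton. -/
def recognised {S : Type v} [Blank S] (α : Ordinal.{u}) {r : ℕ}
    (A : OrdinalAutomaton (Fin r → S)) : Set (Fin r → FinWord S α) :=
  {w | conv w ∈ language α A}

/-- An automaton over `S` of dimension `1 + p`, for some `p : ℕ`, together with `p`. -/
abbrev ParamAutomaton (S : Type v) : Type (max 1 v) :=
  Σ p : ℕ, OrdinalAutomaton (Fin (p + 1) → S)

section GrowthRate

variable {S : Type v} [Blank S] {α : Ordinal.{u}}

/-- `a ∼ a'`: the words `a` and `a'` are indistinguishable by the automata from `Φ` with parameters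
from `E`. -/
def Indist (Φ : Set (ParamAutomaton S)) (E : Set (FinWord S α)) (a a' : FinWord S α) : Prop :=
  ∀ A ∈ Φ, ∀ e : Fin A.1 → FinWord S α, (∀ i, e i ∈ E) →
    ((Fin.cons a e : Fin (A.1 + 1) → FinWord S α) ∈ recognised α A.2 ↔
      (Fin.cons a' e : Fin (A.1 + 1) → FinWord S α) ∈ recognised α A.2)

/-- `G` is `E`-`Φ`-free: its elements are pairwise distinguishable. -/
def IsFree (Φ : Set (ParamAutomaton S)) (E G : Set (FinWord S α)) : Prop :=
  ∀ a ∈ G, ∀ a' ∈ G, a ≠ a' → ¬ Indist Φ E a a'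

/-- `G` is a maximal `E`-`Φ`-free subset of the domain `D`. -/
def IsMaximalFree (D : Set (FinWord S α)) (Φ : Set (ParamAutomaton S))
    (E G : Set (FinWord S α)) : Prop :=
  Maximal (fun G' => G' ⊆ D ∧ IsFree Φ E G') G

/-- The size of `G` measured by `𝓕`: the maximal size of a member of `𝓕` that is contained
in `G`. -/
noncomputable def sizeIn (𝓕 : Set (Set (FinWord S α))) (G : Set (FinWord S α)) : ℕ∞ :=
  sSup {k | ∃ F ∈ 𝓕, F ⊆ G ∧ k = F.encard}

/-- `ν(E)`: the minimal size, measured by `𝓕`, of a maximal `E`-`Φ`-free set. -/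
noncomputable def growthAt (D : Set (FinWord S α)) (Φ : Set (ParamAutomaton S))
    (𝓕 : Set (Set (FinWord S α))) (E : Set (FinWord S α)) : ℕ∞ :=
  sInf {k | ∃ G, IsMaximalFree D Φ E G ∧ k = sizeIn 𝓕 G}

/-- `ν(n)`: the infimum of `ν(E)` over all `E ∈ 𝓕` with exactly `n` elements, with
`inf ∅ = ∞`. -/
noncomputable def growth (D : Set (FinWord S α)) (Φ : Set (ParamAutomaton S))
    (𝓕 : Set (Set (FinWord S α))) (n : ℕ) : ℕ∞ :=
  sInf {k | ∃ E ∈ 𝓕, E.encard = n ∧ k = growthAt D Φ 𝓕 E}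

end GrowthRate

end OrdinalAutomatic

open OrdinalAutomatic

/-! Suppose `ν(n) > n ^ c` for all large `n`. Choosing `E ∈ 𝓕` and then a largest member of `𝓕`
inside a maximal `E`-`Φ`-free set gives a set of size more than `|E| ^ c`; iterating, sizes grow
doubly exponentially in the number `i` of rounds. The contradiction is that the sets can be confined
to words whose support lies in a set of size polynomial in `i`, so that their size is at most `|S|`
to a polynomial in `i`.

Confinement rests on a finite set `D` (`exists_finite_pumping_set`): on a stretch of length `ω ^ e`
where the parameters are blank, a word can be replaced by one supported in `D` with the same
behaviour. If the parameters live on `V`, whose consecutive elements differ by powers of `ω`, then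
every word is indistinguishable from one supported in `V ∪ (V + 1 + D)`
(`exists_indist_mem_wordsOn`), and these finitely many words contain a maximal free set
(`exists_isMaximalFree`).

Iterating `V ↦ V + 1 + D` naively would square or worse; a grid of Cantor normal forms over a fixed
list of `k` exponents is better. By absorption, adding an element of `grid K L` raises the
coefficient bound only by `K` (`add_mem_grid`), so after `i` rounds `V` has at most `(N + i * K + 1)
^ k` elements. -/

namespace OrdinalAutomatic

open Order

/-! ### Runs on segments: composition and translation -/

section Segments

variable {T : Type v}

theorem cofinalImages_congr {Q : Type} {r r' : Ordinal.{u} → Q} {x β : Ordinal.{u}} (hx : x < β)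
    (h : ∀ γ, x < γ → γ < β → r γ = r' γ) : cofinalImages r β = cofinalImages r' β := by
  ext q
  constructor
  · intro hq β' hβ'
    obtain ⟨γ, h1, h2, h3⟩ := hq (max x β') (max_lt hx hβ')
    exact ⟨γ, (le_max_right _ _).trans_lt h1, h2,
      (h γ ((le_max_left _ _).trans_lt h1) h2).symm.trans h3⟩
  · intro hq β' hβ'
    obtain ⟨γ, h1, h2, h3⟩ := hq (max x β') (max_lt hx hβ')
    exact ⟨γ, (le_max_right _ _).trans_lt h1, h2,
      (h γ ((le_max_left _ _).trans_lt h1) h2).trans h3⟩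

theorem cofinalImages_shift {Q : Type} (r : Ordinal.{u} → Q) (x β : Ordinal.{u}) (hβ : 0 < β) :
    cofinalImages r (x + β) = cofinalImages (fun γ => r (x + γ)) β := by
  ext q
  constructor
  · intro hq β' hβ'
    obtain ⟨γ, h1, h2, h3⟩ := hq (x + β') (by simpa using hβ')
    have hxγ : x ≤ γ := le_self_add.trans h1.le
    have he := Ordinal.add_sub_cancel_of_le hxγ
    refine ⟨γ - x, ?_, ?_, ?_⟩
    · rwa [← he, add_lt_add_iff_left] at h1
    · rwa [← he, add_lt_add_iff_left] at h2
    · simpa only [he] using h3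
  · intro hq β' hβ'
    obtain ⟨γ, h1, h2, h3⟩ := hq (β' - x) (Ordinal.sub_lt_of_lt_add hβ' hβ)
    exact ⟨x + γ, (Ordinal.le_add_sub β' x).trans_lt (add_lt_add_right h1 x), by simpa using h2, h3⟩

/-- The pairs of states joined by a run on the segment `[x, y)` of `a`. -/
def segment (A : OrdinalAutomaton T) (a : Ordinal.{u} → T) (x y : Ordinal.{u}) :
    Set (A.Q × A.Q) :=
  {p | ∃ r : Ordinal.{u} → A.Q, r x = p.1 ∧ r y = p.2 ∧
    (∀ β, x ≤ β → β < y → (r β, a β, r (β + 1)) ∈ A.succTrans) ∧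
    ∀ β, x < β → β ≤ y → IsSuccLimit β → (cofinalImages r β, r β) ∈ A.limTrans}

theorem segment_congr (A : OrdinalAutomaton T) {a b : Ordinal.{u} → T} {x y : Ordinal.{u}}
    (h : ∀ β, x ≤ β → β < y → a β = b β) : segment A a x y = segment A b x y := by
  ext p
  refine exists_congr fun r => and_congr_right fun _ => and_congr_right fun _ =>
    and_congr_left fun _ => forall_congr' fun β => forall_congr' fun h1 => forall_congr' fun h2 => ?_
  rw [h β h1 h2]

/-- Runs on consecutive segments compose. -/
theorem mem_segment_trans (A : OrdinalAutomaton T) (a : Ordinal.{u} → T) {x y z : Ordinal.{u}}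
    (hxy : x ≤ y) (hyz : y ≤ z) (p q : A.Q) :
    (p, q) ∈ segment A a x z ↔ ∃ s, (p, s) ∈ segment A a x y ∧ (s, q) ∈ segment A a y z := by
  classical
  constructor
  · rintro ⟨r, h1, h2, h3, h4⟩
    exact ⟨r y, ⟨r, h1, rfl, fun β hβ hβ' => h3 β hβ (hβ'.trans_le hyz),
      fun β hβ hβ' => h4 β hβ (hβ'.trans hyz)⟩, ⟨r, rfl, h2, fun β hβ => h3 β (hxy.trans hβ),
      fun β hβ => h4 β (hxy.trans_lt hβ)⟩⟩
  · rintro ⟨s, ⟨r, h1, h2, h3, h4⟩, ⟨r', h1', h2', h3', h4'⟩⟩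
    dsimp only at h1 h2 h1' h2'
    -- Gluing is consistent since both runs take the value `s` at `y`. A limit at `y` itself belongs
    -- to the left segment, and limits beyond `y` only see values of the right run.
    have hlow : ∀ β ≤ y, (fun β => if β ≤ y then r β else r' β) β = r β := fun β hβ => if_pos hβ
    have hhigh : ∀ β, y ≤ β → (fun β => if β ≤ y then r β else r' β) β = r' β := by
      intro β hβ
      by_cases h : β ≤ y
      · obtain rfl := h.antisymm hβ
        simp [h2, h1']
      · exact if_neg h
    generalize (fun β => if β ≤ y then r β else r' β) = R at hlow hhigh
    refine ⟨R, (hlow x hxy).trans h1, (hhigh z hyz).trans h2', fun β hβ hβ' => ?_,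
      fun β hβ hβ' hl => ?_⟩
    · rcases lt_or_ge β y with h | h
      · rw [hlow β h.le, hlow _ (Order.add_one_le_of_lt h)]
        exact h3 β hβ h
      · rw [hhigh β h, hhigh _ (h.trans le_self_add)]
        exact h3' β h hβ'
    · rcases le_or_gt β y with h | h
      · rw [hlow β h, cofinalImages_congr hβ fun γ _ hγ => hlow γ (hγ.le.trans h)]
        exact h4 β hβ h hl
      · rw [hhigh β h.le, cofinalImages_congr h fun γ hγ _ => hhigh γ hγ.le]
        exact h4' β h hβ' hl

theorem segment_trans_congr {A : OrdinalAutomaton T} {a b : Ordinal.{u} → T}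
    {x y z : Ordinal.{u}} {x' y' z' : Ordinal.{u}} (hxy : x ≤ y) (hyz : y ≤ z)
    (hxy' : x' ≤ y') (hyz' : y' ≤ z') (h1 : segment A a x y = segment A b x' y')
    (h2 : segment A a y z = segment A b y' z') : segment A a x z = segment A b x' z' := by
  ext ⟨p, q⟩
  rw [mem_segment_trans A a hxy hyz, mem_segment_trans A b hxy' hyz', h1, h2]

/-- Runs on a segment do not depend on its position. -/
theorem segment_shift (A : OrdinalAutomaton T) (a : Ordinal.{u} → T) (x y : Ordinal.{u}) :
    segment A a x (x + y) = segment A (fun β => a (x + β)) 0 y := by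
  ext p
  constructor
  · rintro ⟨r, h1, h2, h3, h4⟩
    refine ⟨fun β => r (x + β), by simpa using h1, h2, fun β _ hβ => ?_, fun β hβ hβ' hl => ?_⟩
    · have := h3 (x + β) le_self_add (by simpa using hβ)
      rwa [add_assoc] at this
    · rw [← cofinalImages_shift r x β hβ]
      exact h4 (x + β) (by simpa using hβ) (by simpa using hβ') (Ordinal.isSuccLimit_add x hl)
  · rintro ⟨r, h1, h2, h3, h4⟩
    have hr : ∀ β, r (x + β - x) = r β := fun β => by rw [Ordinal.add_sub_cancel]
    refine ⟨fun β => r (β - x), by simpa using h1, (hr y).trans h2, fun β hβ hβ' => ?_,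
      fun β hβ hβ' hl => ?_⟩
    · obtain ⟨γ, rfl⟩ : ∃ γ, β = x + γ := ⟨β - x, (Ordinal.add_sub_cancel_of_le hβ).symm⟩
      have := h3 γ (zero_le) (by simpa using hβ')
      simp only [hr, add_assoc]
      exact this
    · obtain ⟨γ, rfl⟩ : ∃ γ, β = x + γ := ⟨β - x, (Ordinal.add_sub_cancel_of_le hβ.le).symm⟩
      have hγ : 0 < γ := by simpa using hβ
      have hlγ : IsSuccLimit γ := by
        have := Ordinal.isSuccLimit_sub hl.isSuccPrelimit hβ
        rwa [Ordinal.add_sub_cancel] at this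
      rw [cofinalImages_shift _ x γ hγ]
      simp only [hr]
      exact h4 γ hγ (by simpa using hβ') hlγ

/-- The extension of an `(α)`-word by blanks. -/
noncomputable def FinWord.extend [Blank T] {α : Ordinal.{u}} (w : FinWord T α) (β : Ordinal.{u}) :
    T :=
  open Classical in if h : β < α then w.1 ⟨β, h⟩ else Blank.blank

theorem mem_language_iff [Blank T] {α : Ordinal.{u}} {A : OrdinalAutomaton T} {w : FinWord T α} :
    w ∈ language α A ↔ ∃ p ∈ A.start, ∃ q ∈ A.accept, (p, q) ∈ segment A w.extend 0 α := by
  constructor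
  · rintro ⟨r, hr, h0, h1⟩
    refine ⟨_, h0, _, h1, r, rfl, rfl, fun β _ hβ => ?_, fun β _ => hr.lim_mem β⟩
    rw [FinWord.extend, dif_pos hβ]
    exact hr.succ_mem β hβ
  · rintro ⟨p, hp, q, hq, r, rfl, rfl, h3, h4⟩
    refine ⟨r, ⟨fun β hβ => ?_, fun β hβ hl => h4 β (pos_iff_ne_zero.2
      (Ordinal.isSuccLimit_iff.1 hl).1) hβ hl⟩, hp, hq⟩
    have := h3 β (zero_le) hβ
    rwa [FinWord.extend, dif_pos hβ] at this

/-- The automaton reading `s` as `A` reads `f s`. -/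
def OrdinalAutomaton.comap {S T : Type v} (A : OrdinalAutomaton T) (f : S → T) :
    OrdinalAutomaton S where
  Q := A.Q
  finite_states := A.finite_states
  start := A.start
  accept := A.accept
  succTrans := {t | (t.1, f t.2.1, t.2.2) ∈ A.succTrans}
  limTrans := A.limTrans

theorem segment_comap {S T : Type v} (A : OrdinalAutomaton T) (f : S → T) (a : Ordinal.{u} → S)
    (x y : Ordinal.{u}) : segment (A.comap f) a x y = segment A (fun β => f (a β)) x y := rfl

end Segments

/-! ### A finite set of supports realising every behaviour -/

section Pumping

variable {S : Type v} [Blank S]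

/-- The support of a word indexed by all ordinals. -/
def supp (a : Ordinal.{u} → S) : Set Ordinal.{u} := {β | a β ≠ Blank.blank}

theorem eq_blank_of_notMem_supp {a : Ordinal.{u} → S} {β : Ordinal.{u}} (h : β ∉ supp a) :
    a β = Blank.blank := not_not.1 h

theorem exists_lt_of_finite {γ : Ordinal.{u}} (hγ : IsSuccLimit γ) {s : Set Ordinal.{u}}
    (hs : s.Finite) (h : ∀ β ∈ s, β < γ) : ∃ z < γ, ∀ β ∈ s, β < z := by
  rcases s.eq_empty_or_nonempty with rfl | hne
  · exact ⟨0, hγ.bot_lt, by simp⟩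
  · obtain ⟨m, hm, hmax⟩ := Set.exists_max_image s id hs hne
    exact ⟨succ m, hγ.succ_lt (h m hm), fun β hβ => lt_succ_of_le (hmax β hβ)⟩

/-- `D` suffices as support for words of additively indecomposable limit length, up to behaviour
under the automata in `Ψ`. -/
def IsPumpingSet (Ψ : Set (OrdinalAutomaton S)) (D : Set Ordinal.{u}) : Prop :=
  ∀ γ : Ordinal.{u}, IsSuccLimit γ → (∀ z < γ, z + γ = γ) →
    ∀ a : Ordinal.{u} → S, (supp a ∩ Set.Iio γ).Finite →
      ∃ b : Ordinal.{u} → S, supp b ⊆ D ∧ ∀ A ∈ Ψ, segment A a 0 γ = segment A b 0 γ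

/-- Finitely many automata have a finite pumping set: the union of the supports of shortest words,
one for each behaviour. -/
theorem exists_finite_pumping_set {Ψ : Set (OrdinalAutomaton S)} (hΨ : Ψ.Finite) :
    ∃ D : Set Ordinal.{u}, D.Finite ∧ IsPumpingSet Ψ D := by
  classical
  have : Finite Ψ := hΨ
  have : ∀ A : Ψ, Finite (Set (A.1.Q × A.1.Q)) := fun A => by
    have := A.1.finite_states
    infer_instance
  let M := ∀ A : Ψ, Set (A.1.Q × A.1.Q)
  let τ : (Ordinal.{u} → S) → Ordinal.{u} → M := fun a z A => segment A.1 a 0 z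
  let P : M → Ordinal.{u} → Prop := fun t z => ∃ a, (supp a).Finite ∧ supp a ⊆ Set.Iio z ∧ τ a z = t
  -- Minimality of the length `z` ensures that the representative `b` fits wherever a word of type
  -- `t` does. Unrealised types get a dummy.
  have hmin : ∀ t : M, ∃ z : Ordinal.{u}, ∃ b : Ordinal.{u} → S, (supp b).Finite ∧
      ∀ z', P t z' → z ≤ z' ∧ supp b ⊆ Set.Iio z ∧ τ b z = t := by
    intro t
    by_cases h : ∃ z, P t z
    · obtain ⟨z, ⟨b, h1, h2, h3⟩, hz⟩ := WellFounded.has_min (wellFounded_lt (α := Ordinal.{u}))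
        {z | P t z} h
      exact ⟨z, b, h1, fun z' hz' => ⟨not_lt.1 (hz z' hz'), h2, h3⟩⟩
    · refine ⟨0, fun _ => Blank.blank, by simp [supp], fun z' hz' => (h ⟨z', hz'⟩).elim⟩
  choose z b hfin hzb using hmin
  refine ⟨⋃ t, supp (b t), Set.finite_iUnion hfin, fun γ hγ hadd a ha => ?_⟩
  obtain ⟨y, hy, hay⟩ := exists_lt_of_finite hγ ha fun β hβ => hβ.2
  have hblank : ∀ β, y ≤ β → β < γ → a β = Blank.blank := fun β h1 h2 =>
    eq_blank_of_notMem_supp fun h => (hay β ⟨h, h2⟩).not_ge h1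
  -- Truncation is needed because `a` may have support beyond `γ`.
  let a' : Ordinal.{u} → S := fun β => if β < y then a β else Blank.blank
  have hsupp : supp a' ⊆ supp a ∩ Set.Iio y := by
    intro β hβ
    by_cases h : β < y
    · simp only [supp, a', Set.mem_ofPred_eq, if_pos h] at hβ
      exact ⟨hβ, h⟩
    · exact (hβ (if_neg h)).elim
  have hP : P (τ a' y) y := ⟨a', ha.subset fun β hβ => ⟨(hsupp hβ).1, (hsupp hβ).2.trans hy⟩,
    fun β hβ => (hsupp hβ).2, rfl⟩
  obtain ⟨h1, h2, h3⟩ := hzb _ y hP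
  set t := τ a' y
  refine ⟨b t, Set.subset_iUnion (fun t => supp (b t)) t, fun A hA => ?_⟩
  -- All blank tails of `[0, γ)` behave alike, since `x + γ = γ`; hence the prefixes `[0, y)` and
  -- `[0, z t)` may differ in length.
  have tail : ∀ (c : Ordinal.{u} → S) (x : Ordinal.{u}), x < γ →
      (∀ β, x ≤ β → β < γ → c β = Blank.blank) →
      segment A c x γ = segment A (fun _ => Blank.blank) 0 γ := by
    intro c x hx hc
    have := segment_shift A c x γ
    rw [hadd x hx] at this
    rw [this]
    refine segment_congr A fun β _ hβ => hc _ le_self_add ?_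
    rw [← hadd x hx]
    simpa using hβ
  refine segment_trans_congr (zero_le) hy.le (zero_le) (h1.trans hy.le) ?_ ?_
  · have e1 : segment A a 0 y = segment A a' 0 y :=
      segment_congr A fun β _ hβ => (if_pos hβ).symm
    rw [e1]
    exact (congrFun h3 ⟨A, hA⟩).symm
  · rw [tail a y hy hblank, tail (b t) (z t) (h1.trans_lt hy) fun β hβ _ =>
      eq_blank_of_notMem_supp fun h => (h2 h).not_ge hβ]

end Pumping

/-! ### Grids of Cantor normal forms -/

section Grid

open Ordinal

/-- The ordinals `ω ^ e₁ * c₁ + ⋯ + ω ^ eₖ * cₖ` with `c₁, …, cₖ ≤ N`. -/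
def grid (N : ℕ) : List Ordinal.{u} → Set Ordinal.{u}
  | [] => {0}
  | e :: L => {x | ∃ c ≤ N, ∃ y ∈ grid N L, x = ω ^ e * (c : Ordinal) + y}

theorem grid_finite_card (N : ℕ) (L : List Ordinal.{u}) :
    (grid N L).Finite ∧ (grid N L).ncard ≤ (N + 1) ^ L.length := by
  induction L with
  | nil => simp [grid]
  | cons e L ih =>
    have h : grid N (e :: L) = (fun p : ℕ × Ordinal.{u} => ω ^ e * (p.1 : Ordinal) + p.2) ''
        (Set.Iic N ×ˢ grid N L) := by
      ext x
      simp only [grid, Set.mem_ofPred_eq, Set.mem_image, Set.mem_prod, Set.mem_Iic, Prod.exists]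
      constructor
      · rintro ⟨c, hc, y, hy, rfl⟩
        exact ⟨c, y, ⟨hc, hy⟩, rfl⟩
      · rintro ⟨c, y, ⟨hc, hy⟩, rfl⟩
        exact ⟨c, hc, y, hy, rfl⟩
    have hf := (Set.finite_Iic N).prod ih.1
    rw [h]
    refine ⟨hf.image _, (Set.ncard_image_le hf).trans ?_⟩
    rw [Set.ncard_prod, List.length_cons, pow_succ']
    refine Nat.mul_le_mul (le_of_eq ?_) ih.2
    rw [← Nat.card_coe_set_eq]
    simp

theorem zero_mem_grid (N : ℕ) (L : List Ordinal.{u}) : 0 ∈ grid N L := by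
  induction L with
  | nil => rfl
  | cons e L ih => exact ⟨0, N.zero_le, 0, ih, by simp⟩

theorem grid_mono {N N' : ℕ} (h : N ≤ N') (L : List Ordinal.{u}) : grid N L ⊆ grid N' L := by
  induction L with
  | nil => exact subset_rfl
  | cons e L ih =>
    rintro _ ⟨c, hc, y, hy, rfl⟩
    exact ⟨c, hc.trans h, y, ih hy, rfl⟩

theorem lt_opow_of_mem_grid {N : ℕ} {L : List Ordinal.{u}} {e x : Ordinal.{u}}
    (hL : ∀ f ∈ L, f < e) (hx : x ∈ grid N L) : x < ω ^ e := by
  induction L generalizing x with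
  | nil =>
    obtain rfl : x = 0 := hx
    exact opow_pos e omega0_pos
  | cons f L ih =>
    obtain ⟨c, -, y, hy, rfl⟩ := hx
    exact isPrincipal_add_omega0_opow e (opow_mul_lt_opow (natCast_lt_omega0 c) (hL f (by simp)))
      (ih (fun f hf => hL f (by simp [hf])) hy)

/-- Coefficient bounds add because a sum of Cantor normal forms either adds coefficients or absorbs
lower terms. This keeps the growth of the supports polynomial. -/
theorem add_mem_grid {N N' : ℕ} {L : List Ordinal.{u}} (hL : L.Pairwise (· > ·))
    {x y : Ordinal.{u}} (hx : x ∈ grid N L) (hy : y ∈ grid N' L) : x + y ∈ grid (N + N') L := by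
  induction L generalizing x y with
  | nil =>
    obtain rfl : x = 0 := hx
    obtain rfl : y = 0 := hy
    simp [grid]
  | cons e L ih =>
    obtain ⟨hlt, hL⟩ := List.pairwise_cons.1 hL
    obtain ⟨c, hc, x, hx, rfl⟩ := hx
    obtain ⟨d, hd, y, hy, rfl⟩ := hy
    rcases Nat.eq_zero_or_pos d with rfl | hpos
    · exact ⟨c, by omega, x + y, ih hL hx hy, by simp [add_assoc]⟩
    · refine ⟨c + d, by omega, y, grid_mono (by omega) L hy, ?_⟩
      have h : x + ω ^ e * (d : Ordinal) = ω ^ e * (d : Ordinal) :=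
        add_of_omega0_opow_le (lt_opow_of_mem_grid hlt hx)
          (le_mul_of_one_le_right zero_le (by exact_mod_cast hpos))
      rw [Nat.cast_add, mul_add, add_assoc, ← add_assoc x, h, add_assoc]

theorem opow_mul_mem_grid {L : List Ordinal.{u}} {e : Ordinal.{u}} (he : e ∈ L) (n : ℕ) :
    ω ^ e * (n : Ordinal) ∈ grid n L := by
  induction L with
  | nil => simp at he
  | cons f L ih =>
    by_cases h : e = f
    · subst h
      exact ⟨n, le_rfl, 0, zero_mem_grid n L, by simp⟩
    · exact ⟨0, n.zero_le, _, ih (by simpa [h] using he), by simp⟩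

/-- Consecutive elements of a grid differ by a power of `ω`. -/
theorem exists_eq_add_opow {N : ℕ} {L : List Ordinal.{u}} (hL : L.Pairwise (· > ·))
    {x y : Ordinal.{u}} (hx : x ∈ grid N L) (hy : y ∈ grid N L) (hxy : x < y)
    (hcons : ∀ z ∈ grid N L, x < z → y ≤ z) : ∃ e : Ordinal.{u}, y = x + ω ^ e := by
  induction L generalizing x y with
  | nil =>
    obtain rfl : x = 0 := hx
    obtain rfl : y = 0 := hy
    exact (lt_irrefl _ hxy).elim
  | cons e L ih =>
    obtain ⟨hlt, hL⟩ := List.pairwise_cons.1 hL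
    obtain ⟨c, hc, x, hx, rfl⟩ := hx
    obtain ⟨d, hd, y, hy, rfl⟩ := hy
    have hxe := lt_opow_of_mem_grid hlt hx
    have hye := lt_opow_of_mem_grid hlt hy
    have hstep : ω ^ e * ((c + 1 : ℕ) : Ordinal) = ω ^ e * (c : Ordinal) + x + ω ^ e := by
      rw [add_assoc, add_omega0_opow hxe, Nat.cast_add, mul_add, Nat.cast_one, mul_one]
    rcases lt_trichotomy c d with h | rfl | h
    -- The remainder `x` is absorbed by `ω ^ e`, so the successor in the grid is `ω ^ e * (c + 1)`,
    -- which is present as `c < d ≤ N`.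
    · refine ⟨e, ?_⟩
      rw [← hstep]
      refine le_antisymm (hcons _ ⟨c + 1, by omega, 0, zero_mem_grid N L, by simp⟩ ?_) ?_
      · rw [hstep]
        exact lt_add_of_pos_right _ (opow_pos e omega0_pos)
      · refine le_trans ?_ (le_self_add)
        gcongr
        exact h
    · obtain ⟨f, hf⟩ := ih hL hx hy (by simpa using hxy) fun z hz hxz => by
        simpa using hcons (ω ^ e * (c : Ordinal) + z) ⟨c, hc, z, hz, rfl⟩ (by simpa using hxz)
      exact ⟨f, by rw [hf, add_assoc]⟩
    · exfalso
      refine hxy.not_ge (le_trans ?_ (le_self_add (b := x)))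
      have h1 : ω ^ e * (d : Ordinal) + y ≤ ω ^ e * ((d + 1 : ℕ) : Ordinal) := by
        rw [Nat.cast_add, mul_add, Nat.cast_one, mul_one]
        gcongr
      refine h1.trans ?_
      gcongr
      exact h

/-- `T` collects the exponents of the Cantor normal form of `x`. Allowing every larger list `L` lets
several ordinals share one list. -/
theorem exists_mem_grid (x : Ordinal.{u}) : ∃ (T : Finset Ordinal.{u}) (N : ℕ),
    ∀ L : List Ordinal.{u}, L.Pairwise (· > ·) → (∀ e ∈ T, e ∈ L) → x ∈ grid N L := by
  classical
  induction x using WellFoundedLT.induction with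
  | ind x ih =>
    rcases eq_or_ne x 0 with rfl | hx
    · exact ⟨∅, 0, fun L _ _ => zero_mem_grid 0 L⟩
    · obtain ⟨T, N, h⟩ := ih _ (mod_opow_log_lt_self ω hx)
      obtain ⟨n, hn⟩ := lt_omega0.1 (div_opow_log_lt x one_lt_omega0)
      refine ⟨insert (log ω x) T, n + N, fun L hL hT => ?_⟩
      rw [← div_add_mod x (ω ^ log ω x), hn]
      exact add_mem_grid hL (opow_mul_mem_grid (hT _ (by simp)) n)
        (h L hL fun e he => hT e (by simp [he]))

theorem exists_subset_grid {s : Set Ordinal.{u}} (hs : s.Finite) : ∃ (T : Finset Ordinal.{u})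
    (N : ℕ), ∀ L : List Ordinal.{u}, L.Pairwise (· > ·) → (∀ e ∈ T, e ∈ L) → s ⊆ grid N L := by
  classical
  induction s, hs using Set.Finite.induction_on with
  | empty => exact ⟨∅, 0, fun _ _ _ => Set.empty_subset _⟩
  | @insert x s _ _ ih =>
    obtain ⟨T, N, h⟩ := ih
    obtain ⟨T', N', h'⟩ := exists_mem_grid x
    refine ⟨T ∪ T', max N N', fun L hL hT => Set.insert_subset ?_ ?_⟩
    · exact grid_mono (le_max_right _ _) L (h' L hL fun e he => hT e (by simp [he]))
    · exact (h L hL fun e he => hT e (by simp [he])).trans (grid_mono (le_max_left _ _) L)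

/-- Any two finite sets of ordinals lie in grids over the same exponents. -/
theorem exists_grids {s t : Set Ordinal.{u}} (hs : s.Finite) (ht : t.Finite) :
    ∃ (L : List Ordinal.{u}) (N K : ℕ), L.Pairwise (· > ·) ∧ s ⊆ grid N L ∧ t ⊆ grid K L := by
  classical
  obtain ⟨T, N, h⟩ := exists_subset_grid hs
  obtain ⟨T', K, h'⟩ := exists_subset_grid ht
  have hL := ((T ∪ T').sortedGT_sort).pairwise
  exact ⟨_, N, K, hL, h _ hL (by simp +contextual), h' _ hL (by simp +contextual)⟩

end Grid

/-! ### Replacing a word between the points of `V` -/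

section Replacement

variable {S : Type v} [Blank S]

/-- The letters on `V` are kept, and each gap between consecutive points is refilled by pumping. The
map `f` stands for reading a letter next to blank parameters, which is the situation off `V`. -/
theorem exists_replacement {Ψ : Set (OrdinalAutomaton S)} {D V : Set Ordinal.{u}}
    (hD : IsPumpingSet Ψ D) (hV : V.Finite) (h0 : 0 ∈ V) {α : Ordinal.{u}} (hα : α ∈ V)
    (hgap : ∀ x ∈ V, ∀ y ∈ V, x < y → (∀ z ∈ V, x < z → y ≤ z) →
      ∃ e : Ordinal.{u}, y = x + Ordinal.omega0 ^ e)
    {a : Ordinal.{u} → S} (ha : (supp a).Finite) :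
    ∃ a' : Ordinal.{u} → S, supp a' ⊆ V ∪ Set.image2 (fun x d => x + (1 + d)) V D ∧
      (∀ x ∈ V, a' x = a x) ∧
      ∀ {T : Type v} (A : OrdinalAutomaton T) (f : S → T), A.comap f ∈ Ψ →
        ∀ u u' : Ordinal.{u} → T, (∀ x ∈ V, x < α → u x = u' x) →
          (∀ β < α, β ∉ V → u β = f (a β)) → (∀ β < α, β ∉ V → u' β = f (a' β)) →
          segment A u 0 α = segment A u' 0 α := by
  classical
  have hnext : ∀ x, ∃ e : Ordinal.{u}, x ∈ V → x < α → x + Ordinal.omega0 ^ e ∈ V ∧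
      ∀ z ∈ V, x < z → x + Ordinal.omega0 ^ e ≤ z := by
    intro x
    by_cases hx : x ∈ V ∧ x < α
    · obtain ⟨y, ⟨hy, hxy⟩, hmin⟩ := Set.exists_min_image (V ∩ Set.Ioi x) id
        (hV.subset Set.inter_subset_left) ⟨α, hα, hx.2⟩
      obtain ⟨e, rfl⟩ := hgap x hx.1 y hy hxy fun z hz hxz => hmin z ⟨hz, hxz⟩
      exact ⟨e, fun _ _ => ⟨hy, fun z hz hxz => hmin z ⟨hz, hxz⟩⟩⟩
    · exact ⟨0, fun h1 h2 => (hx ⟨h1, h2⟩).elim⟩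
  choose e he using hnext
  have hfloor : ∀ β, ∃ x ∈ V, x ≤ β ∧ ∀ z ∈ V, z ≤ β → z ≤ x := by
    intro β
    obtain ⟨x, ⟨hx, hxβ⟩, hmax⟩ := Set.exists_max_image (V ∩ Set.Iic β) id
      (hV.subset Set.inter_subset_left) ⟨0, h0, Set.mem_Iic.2 zero_le⟩
    exact ⟨x, hx, hxβ, fun z hz hzβ => hmax z ⟨hz, hzβ⟩⟩
  choose fl hflV hfl hflmax using hfloor
  have hlim : ∀ x, e x ≠ 0 → IsSuccLimit (Ordinal.omega0 ^ e x) := fun x hx =>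
    Ordinal.isSuccLimit_opow_left Ordinal.isSuccLimit_omega0 hx
  have hb : ∀ x, ∃ b : Ordinal.{u} → S, supp b ⊆ D ∧ (e x ≠ 0 → ∀ A ∈ Ψ,
      segment A (fun β => a (x + 1 + β)) 0 (Ordinal.omega0 ^ e x) =
        segment A b 0 (Ordinal.omega0 ^ e x)) := by
    intro x
    by_cases hx : e x = 0
    · exact ⟨fun _ => Blank.blank, by simp [supp], fun h => (h hx).elim⟩
    · have hfin : (supp fun β => a (x + 1 + β)).Finite :=
        ha.preimage (f := fun β => x + 1 + β) fun β _ γ _ h => by simpa using h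
      obtain ⟨b, h1, h2⟩ := hD _ (hlim x hx) (fun z hz => Ordinal.add_omega0_opow hz) _
        (hfin.subset Set.inter_subset_left)
      exact ⟨b, h1, fun _ => h2⟩
  choose b hbD hbseg using hb
  have hflid : ∀ x ∈ V, fl x = x := fun x hx => (hfl x).antisymm (hflmax x x hx le_rfl)
  -- `fl β` is the last point of `V` up to `β`. The word `b (fl β)` starts right after it, hence the
  -- shift by `fl β + 1`.
  refine ⟨fun β => if fl β = β then a β else b (fl β) (β - (fl β + 1)), fun β hβ => ?_,
    fun x hx => if_pos (hflid x hx), fun {T} A f hA u u' hV' hu hu' => ?_⟩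
  · by_cases h : fl β = β
    · exact .inl (h ▸ hflV β)
    · have hlt : fl β + 1 ≤ β := Order.add_one_le_of_lt ((hfl β).lt_of_ne h)
      simp only [supp, Set.mem_ofPred_eq, if_neg h] at hβ
      refine .inr ⟨fl β, hflV β, _, hbD _ hβ, ?_⟩
      simp only [← add_assoc]
      exact Ordinal.add_sub_cancel_of_le hlt
  · suffices h : ∀ y ∈ V, y ≤ α → segment A u 0 y = segment A u' 0 y from h α hα le_rfl
    intro y
    induction y using WellFoundedLT.induction with
    | ind y ih =>
      intro hy hyα
      rcases eq_or_ne y 0 with rfl | hy0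
      · exact segment_congr A fun β _ hβ => (not_lt_zero hβ).elim
      obtain ⟨x, ⟨hx, hxy⟩, hmax⟩ := Set.exists_max_image (V ∩ Set.Iio y) id
        (hV.subset Set.inter_subset_left) ⟨0, h0, pos_iff_ne_zero.2 hy0⟩
      have hxy : x < y := hxy
      have hxα := hxy.trans_le hyα
      obtain ⟨hn, hnmin⟩ := he x hx hxα
      have hpos : (0 : Ordinal.{u}) < Ordinal.omega0 ^ e x :=
        Ordinal.opow_pos _ Ordinal.omega0_pos
      obtain rfl : x + Ordinal.omega0 ^ e x = y := by
        refine (hnmin y hy hxy).antisymm (not_lt.1 fun h => ?_)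
        exact (lt_add_of_pos_right x hpos).not_ge (hmax _ ⟨hn, h⟩)
      have hnot : ∀ β, x < β → β < x + Ordinal.omega0 ^ e x → β ∉ V := fun β h1 h2 h =>
        (hnmin β h h1).not_gt h2
      refine segment_trans_congr zero_le hxy.le zero_le hxy.le (ih x hxy hx hxα.le) ?_
      have hletter : segment A u x (x + 1) = segment A u' x (x + 1) := by
        refine segment_congr A fun β h1 h2 => ?_
        obtain rfl : β = x := (Order.le_of_lt_add_one h2).antisymm h1
        exact hV' β hx hxα
      by_cases hex : e x = 0
      · simpa only [hex, Ordinal.opow_zero] using hletter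
      -- Removing the letter at `x` leaves a gap still of length `ω ^ e x`, to which pumping
      -- applies.
      have hone : 1 + Ordinal.omega0 ^ e x = Ordinal.omega0 ^ e x :=
        Ordinal.add_omega0_opow (Ordinal.one_lt_of_isSuccLimit (hlim x hex))
      have hle : x + 1 ≤ x + Ordinal.omega0 ^ e x := Order.add_one_le_of_lt hxy
      refine segment_trans_congr le_self_add hle le_self_add hle hletter ?_
      have hsplit : x + Ordinal.omega0 ^ e x = x + 1 + Ordinal.omega0 ^ e x := by
        rw [add_assoc, hone]
      rw [hsplit, segment_shift, segment_shift]
      have hmem : ∀ β < Ordinal.omega0 ^ e x, x < x + 1 + β ∧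
          x + 1 + β < x + Ordinal.omega0 ^ e x := fun β hβ =>
        ⟨(Order.lt_add_one_iff.2 le_rfl).trans_le le_self_add,
          by rw [hsplit]; exact add_lt_add_right hβ _⟩
      have e1 : segment A (fun β => u (x + 1 + β)) 0 (Ordinal.omega0 ^ e x) =
          segment (A.comap f) (fun β => a (x + 1 + β)) 0 (Ordinal.omega0 ^ e x) := by
        rw [segment_comap]
        refine segment_congr A fun β _ hβ => ?_
        obtain ⟨h1, h2⟩ := hmem β hβ
        exact hu _ (h2.trans_le hyα) (hnot _ h1 h2)
      have e2 : segment A (fun β => u' (x + 1 + β)) 0 (Ordinal.omega0 ^ e x) =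
          segment (A.comap f) (b x) 0 (Ordinal.omega0 ^ e x) := by
        rw [segment_comap]
        refine segment_congr A fun β _ hβ => ?_
        obtain ⟨h1, h2⟩ := hmem β hβ
        have hflx : fl (x + 1 + β) = x := by
          refine le_antisymm (not_lt.1 fun h => ?_) (hflmax _ x hx h1.le)
          exact ((hnmin _ (hflV _) h).trans (hfl _)).not_gt h2
        simp only [hu' _ (h2.trans_le hyα) (hnot _ h1 h2), hflx, if_neg h1.ne,
          Ordinal.add_sub_cancel]
      rw [e1, e2]
      exact hbseg x hex _ hA

variable {α : Ordinal.{u}}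

/-- The `(α)`-words with support in `V`. -/
def wordsOn (S : Type v) [Blank S] (α : Ordinal.{u}) (V : Set Ordinal.{u}) : Set (FinWord S α) :=
  {w | supp w.extend ⊆ V}

theorem FinWord.extend_of_lt {T : Type v} [Blank T] (w : FinWord T α) {β : Ordinal.{u}}
    (h : β < α) : w.extend β = w.1 ⟨β, h⟩ := dif_pos h

theorem FinWord.finite_supp_extend (w : FinWord S α) : (supp w.extend).Finite := by
  refine (w.2.image Subtype.val).subset fun β hβ => ?_
  by_cases h : β < α
  · refine ⟨⟨β, h⟩, ?_, rfl⟩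
    rw [Set.mem_ofPred_eq, ← w.extend_of_lt h]
    exact hβ
  · exact (hβ (dif_neg h)).elim

theorem extend_conv_cons {p : ℕ} (w : FinWord S α) (e : Fin p → FinWord S α) {β : Ordinal.{u}}
    (h : β < α) : (conv (Fin.cons w e : Fin (p + 1) → FinWord S α)).extend β =
      Fin.cons (w.extend β) fun i => (e i).extend β := by
  rw [FinWord.extend_of_lt _ h]
  funext i
  refine Fin.cases ?_ (fun i => ?_) i
  · exact (w.extend_of_lt h).symm
  · exact ((e i).extend_of_lt h).symm

/-- The automata over `S` that describe the behaviour of `B` and, on segments where the parameters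
are blank, of the automata in `Φ`. -/
def behaviours (B : OrdinalAutomaton S) (Φ : Set (ParamAutomaton S)) : Set (OrdinalAutomaton S) :=
  insert (B.comap id) ((fun A : ParamAutomaton S => A.2.comap fun s =>
    (Fin.cons s (fun _ => Blank.blank) : Fin (A.1 + 1) → S)) '' Φ)

theorem exists_indist_mem_wordsOn {B : OrdinalAutomaton S} {Φ : Set (ParamAutomaton S)}
    {D V : Set Ordinal.{u}} (hD : IsPumpingSet (behaviours B Φ) D) (hDfin : D.Finite)
    (hV : V.Finite) (h0 : 0 ∈ V) (hα : α ∈ V)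
    (hgap : ∀ x ∈ V, ∀ y ∈ V, x < y → (∀ z ∈ V, x < z → y ≤ z) →
      ∃ e : Ordinal.{u}, y = x + Ordinal.omega0 ^ e)
    {E : Set (FinWord S α)} (hE : E ⊆ wordsOn S α V) (w : FinWord S α) (hw : w ∈ language α B) :
    ∃ w' ∈ wordsOn S α (V ∪ Set.image2 (fun x d => x + (1 + d)) V D),
      w' ∈ language α B ∧ Indist Φ E w w' := by
  obtain ⟨a', hsupp, hagree, hseg⟩ := exists_replacement hD hV h0 hα hgap w.finite_supp_extend
  have hfin : (supp a').Finite := (hV.union (hV.image2 _ hDfin)).subset hsupp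
  let w' : FinWord S α := ⟨fun β => a' β, hfin.preimage Subtype.val_injective.injOn⟩
  have hw' : ∀ β < α, w'.extend β = a' β := fun β hβ => w'.extend_of_lt hβ
  refine ⟨w', fun β hβ => hsupp ?_, ?_, fun A hA e he => ?_⟩
  · by_cases h : β < α
    · rwa [supp, Set.mem_ofPred_eq, hw' β h] at hβ
    · exact (hβ (dif_neg h)).elim
  · rw [mem_language_iff] at hw ⊢
    rwa [← hseg B id (.inl rfl) w.extend w'.extend (fun x hx h => by rw [hw' x h, hagree x hx])
      (fun _ _ _ => rfl) fun β h _ => hw' β h]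
  -- Off `V` the convolution with `e` is determined by the letter of the first word alone, as in the
  -- automata of `behaviours`.
  · have hblank : ∀ β, β ∉ V → ∀ i, (e i).extend β = Blank.blank := fun β hβ i =>
      eq_blank_of_notMem_supp fun h => hβ (hE (he i) h)
    simp only [recognised, Set.mem_ofPred_eq, mem_language_iff]
    rw [hseg A.2 _ (.inr ⟨A, hA, rfl⟩)
      (conv (Fin.cons w e : Fin (A.1 + 1) → FinWord S α)).extend
      (conv (Fin.cons w' e : Fin (A.1 + 1) → FinWord S α)).extend]
    · intro x hx h
      rw [extend_conv_cons w e h, extend_conv_cons w' e h, hw' x h, hagree x hx]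
    · intro β h hβ
      rw [extend_conv_cons w e h]
      simp only [hblank β hβ]
    · intro β h hβ
      rw [extend_conv_cons w' e h, hw' β h]
      simp only [hblank β hβ]

theorem wordsOn_finite_ncard [Finite S] {V : Set Ordinal.{u}} (hV : V.Finite) :
    (wordsOn S α V).Finite ∧ (wordsOn S α V).ncard ≤ Nat.card S ^ V.ncard := by
  have := hV.to_subtype
  let g : wordsOn S α V → V → S := fun w x => w.1.extend x
  have hg : Function.Injective g := by
    rintro ⟨w, hw⟩ ⟨w', hw'⟩ h
    refine Subtype.ext (Subtype.ext (funext fun ⟨β, hβ⟩ => ?_))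
    change w.1 ⟨β, hβ⟩ = w'.1 ⟨β, hβ⟩
    rw [← w.extend_of_lt hβ, ← w'.extend_of_lt hβ]
    by_cases hV' : β ∈ V
    · exact congrFun h ⟨β, hV'⟩
    · rw [eq_blank_of_notMem_supp fun h => hV' (hw h), eq_blank_of_notMem_supp fun h => hV' (hw' h)]
  have hfin : Finite (wordsOn S α V) := Finite.of_injective g hg
  refine ⟨hfin, ?_⟩
  rw [← Nat.card_coe_set_eq, ← Nat.card_coe_set_eq, ← Nat.card_fun]
  exact Nat.card_le_card_of_injective g hg

end Replacement

/-! ### Maximal free sets and the growth estimate -/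

section Growth

variable {S : Type v} [Blank S] {α : Ordinal.{u}} {Φ : Set (ParamAutomaton S)}
  {E : Set (FinWord S α)}

theorem Indist.symm {a b : FinWord S α} (h : Indist Φ E a b) : Indist Φ E b a :=
  fun A hA e he => (h A hA e he).symm

theorem Indist.trans {a b c : FinWord S α} (h : Indist Φ E a b) (h' : Indist Φ E b c) :
    Indist Φ E a c :=
  fun A hA e he => (h A hA e he).trans (h' A hA e he)

/-- A free subset of `U` that is maximal within `U` meets every class of indistinguishability,
because `U` does; so no element of `D` can be added. -/
theorem exists_isMaximalFree {D U : Set (FinWord S α)} (hU : U.Finite) (hUD : U ⊆ D)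
    (h : ∀ w ∈ D, ∃ w' ∈ U, Indist Φ E w w') : ∃ G ⊆ U, IsMaximalFree D Φ E G := by
  have hfin : {G | G ⊆ U ∧ IsFree Φ E G}.Finite := hU.finite_subsets.subset fun G hG => hG.1
  obtain ⟨G, hG⟩ := hfin.exists_maximal ⟨∅, Set.empty_subset _, fun a ha => ha.elim⟩
  refine ⟨G, hG.1.1, ⟨hG.1.1.trans hUD, hG.1.2⟩, fun G' hG' hle w hw => ?_⟩
  obtain ⟨w', hw', hww'⟩ := h w (hG'.1 hw)
  obtain ⟨g, hg, hgw⟩ : ∃ g ∈ G, Indist Φ E w' g := by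
    by_contra! hno
    have hfree : IsFree Φ E (insert w' G) := by
      rintro a (rfl | ha) b (rfl | hb) hab
      · exact (hab rfl).elim
      · exact hno b hb
      · exact fun hi => hno a ha hi.symm
      · exact hG.1.2 a ha b hb hab
    have := hG.2 ⟨Set.insert_subset hw' hG.1.1, hfree⟩ (Set.subset_insert w' G)
      (Set.mem_insert w' G)
    exact hno w' this fun A _ e _ => Iff.rfl
  by_contra hwG
  exact hG'.2 w hw g (hle hg) (fun h => hwG (h ▸ hg)) (hww'.trans hgw)

theorem exists_growthAt_le {D U : Set (FinWord S α)} (hU : U.Finite) (hUD : U ⊆ D)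
    (h : ∀ w ∈ D, ∃ w' ∈ U, Indist Φ E w w') {𝓕 : Set (Set (FinWord S α))} (hempty : ∅ ∈ 𝓕) :
    ∃ F ∈ 𝓕, F ⊆ U ∧ growthAt D Φ 𝓕 E ≤ F.encard := by
  obtain ⟨G, hGU, hG⟩ := exists_isMaximalFree hU hUD h
  obtain ⟨F, ⟨hF, hFG⟩, hmax⟩ := Set.exists_max_image {F | F ∈ 𝓕 ∧ F ⊆ G} Set.encard
    ((hU.subset hGU).finite_subsets.subset fun F hF => hF.2) ⟨∅, hempty, Set.empty_subset _⟩
  have hle : growthAt D Φ 𝓕 E ≤ sizeIn 𝓕 G := sInf_le ⟨G, hG, rfl⟩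
  refine ⟨F, hF, hFG.trans hGU, hle.trans (sSup_le ?_)⟩
  rintro _ ⟨F', hF', hF'G, rfl⟩
  exact hmax F' ⟨hF', hF'G⟩

/-- Iterated powers eventually exceed every function of the form `s ^ (polynomial)`. -/
theorem not_forall_exp_le {c : ℝ} (hc : 1 < c) (s : ℝ) (N K k : ℕ) :
    ¬ ∀ i : ℕ, c ^ i * Real.log 2 ≤ (N + i * K + 1 : ℝ) ^ k * Real.log s := by
  intro h
  -- For `i ≥ 1` the base is at most `i * (N + K + 1)`. Dividing by `c ^ i` would bound `log 2` by a
  -- sequence tending to `0`.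
  have hlim := (tendsto_pow_const_div_const_pow_of_one_lt k hc).mul_const
    ((N + K + 1 : ℝ) ^ k * |Real.log s|)
  rw [zero_mul] at hlim
  refine (Real.log_pos one_lt_two).not_ge (ge_of_tendsto hlim ?_)
  filter_upwards [Filter.eventually_ge_atTop 1] with i hi
  have hci : 0 < c ^ i := by positivity
  rw [div_mul_eq_mul_div, le_div_iff₀ hci, mul_comm (Real.log 2), ← mul_assoc, ← mul_pow]
  have hi' : (1 : ℝ) ≤ i := by exact_mod_cast hi
  have hN : (0 : ℝ) ≤ N := Nat.cast_nonneg N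
  calc c ^ i * Real.log 2 ≤ (N + i * K + 1 : ℝ) ^ k * Real.log s := h i
    _ ≤ (N + i * K + 1 : ℝ) ^ k * |Real.log s| := by gcongr; exact le_abs_self _
    _ ≤ (i * (N + K + 1)) ^ k * |Real.log s| := by
      gcongr
      nlinarith

end Growth

end OrdinalAutomatic

/-! ### The iteration and the contradiction -/

theorem mainTheorem2 {S : Type v} [Finite S] [Blank S] (α : Ordinal.{u})
    (B : OrdinalAutomaton S)
    (Φ : Set (ParamAutomaton S)) (hΦ : Φ.Finite)
    (𝓕 : Set (Set (FinWord S α))) (h𝓕 : ∀ F ∈ 𝓕, F ⊆ language α B)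
    (hempty : ∅ ∈ 𝓕)
    (hlarge : ∀ N : ℕ, ∃ F ∈ 𝓕, F.Finite ∧ N ≤ F.ncard)
    (c : ℝ) (hc : 1 < c) :
    {n : ℕ | ((growth (language α B) Φ 𝓕 n : ℕ∞) : ENNReal) ≤ (n : ENNReal) ^ c}.Infinite := by
  intro hfin
  obtain ⟨N₁, hN₁⟩ := hfin.bddAbove
  obtain ⟨D, hDfin, hD⟩ := exists_finite_pumping_set.{u} (Ψ := behaviours B Φ)
    ((hΦ.image _).insert _)
  -- More than `N₁` elements put every size in the range where the bound fails; at least `2` make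
  -- the initial logarithm positive.
  obtain ⟨E₀, hE₀, hE₀fin, hE₀card⟩ := hlarge (N₁ + 2)
  -- `α` must be a grid point to close the last gap. The shift `1 + d` matches the supports produced
  -- by the replacement.
  obtain ⟨L, N, K, hL, hN, hK⟩ := exists_grids
    ((hE₀fin.biUnion fun w _ => w.finite_supp_extend).insert α) (hDfin.image (1 + ·))
  have key : ∀ i : ℕ, ∃ F ∈ 𝓕, F ⊆ wordsOn S α (grid (N + i * K) L) ∧ N₁ + 2 ≤ F.ncard ∧
      c ^ i * Real.log 2 ≤ Real.log F.ncard := by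
    intro i
    induction i with
    | zero =>
      refine ⟨E₀, hE₀, fun w hw => ?_, hE₀card, ?_⟩
      · rw [zero_mul, add_zero]
        exact (Set.subset_biUnion_of_mem (u := fun w => supp w.extend) hw).trans
          ((Set.subset_insert _ _).trans hN)
      · rw [pow_zero, one_mul]
        exact Real.log_le_log two_pos (by exact_mod_cast (by omega : 2 ≤ E₀.ncard))
    | succ i ih =>
      obtain ⟨E, hE, hEV, hEcard, hElog⟩ := ih
      set V := grid (N + i * K) L
      have hVfin : V.Finite := (grid_finite_card _ L).1
      have hEfin : E.Finite := (wordsOn_finite_ncard hVfin).1.subset hEV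
      have hU := (wordsOn_finite_ncard (S := S) (α := α) (grid_finite_card (N + (i + 1) * K) L).1).1
      have hsub : V ∪ Set.image2 (fun x d => x + (1 + d)) V D ⊆ grid (N + (i + 1) * K) L := by
        have heq : N + (i + 1) * K = N + i * K + K := by ring
        rw [heq]
        refine Set.union_subset (grid_mono (Nat.le_add_right _ _) L) ?_
        rintro _ ⟨x, hx, d, hd, rfl⟩
        exact add_mem_grid hL hx (hK ⟨d, hd, rfl⟩)
      obtain ⟨F, hF, hFU, hle⟩ := exists_growthAt_le (Φ := Φ) (E := E)
        (hU.inter_of_left (language α B)) Set.inter_subset_right (fun w hw => by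
          obtain ⟨w', h1, h2, h3⟩ := exists_indist_mem_wordsOn hD hDfin hVfin
            (zero_mem_grid _ L) (grid_mono (Nat.le_add_right _ _) L (hN (Set.mem_insert _ _)))
            (fun x hx y hy => exists_eq_add_opow hL hx hy) hEV w hw
          exact ⟨w', ⟨h1.trans hsub, h2⟩, h3⟩) hempty
      have hFV := hFU.trans Set.inter_subset_left
      have hFfin := hU.subset hFV
      have hlt : ((E.ncard : ℕ) : ENNReal) ^ c < ((F.ncard : ℕ) : ENNReal) := by
        have h1 : ¬ ((growth (language α B) Φ 𝓕 E.ncard : ℕ∞) : ENNReal) ≤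
            (E.ncard : ENNReal) ^ c := fun h => by
          have := hN₁ h
          omega
        have h2 : growth (language α B) Φ 𝓕 E.ncard ≤ (F.ncard : ℕ∞) := by
          have h3 : growth (language α B) Φ 𝓕 E.ncard ≤ growthAt (language α B) Φ 𝓕 E :=
            sInf_le ⟨E, hE, hEfin.cast_ncard_eq.symm, rfl⟩
          exact h3.trans (hle.trans hFfin.cast_ncard_eq.ge)
        refine (not_le.1 h1).trans_le ?_
        exact_mod_cast ENat.toENNReal_le.2 h2
      have hreal : (E.ncard : ℝ) ^ c < F.ncard := by
        rw [← ENNReal.ofReal_natCast, ENNReal.ofReal_rpow_of_nonneg (Nat.cast_nonneg _)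
          (by linarith), ← ENNReal.ofReal_natCast, ENNReal.ofReal_lt_ofReal_iff'] at hlt
        exact hlt.1
      have hE1 : (1 : ℝ) ≤ E.ncard := by exact_mod_cast (by omega : 1 ≤ E.ncard)
      refine ⟨F, hF, hFV, ?_, ?_⟩
      · have := (Real.self_le_rpow_of_one_le hE1 hc.le).trans_lt hreal
        exact hEcard.trans (by exact_mod_cast this.le)
      · have h1 := Real.log_le_log (Real.rpow_pos_of_pos (by linarith) c) hreal.le
        rw [Real.log_rpow (by linarith)] at h1
        refine le_trans ?_ h1
        rw [pow_succ', mul_assoc]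
        exact mul_le_mul_of_nonneg_left hElog (by linarith)
  refine not_forall_exp_le hc (Nat.card S) N K L.length fun i => ?_
  obtain ⟨F, -, hFV, hcard, hlog⟩ := key i
  obtain ⟨hgfin, hgcard⟩ := grid_finite_card (N + i * K) L
  obtain ⟨hwfin, hwcard⟩ := wordsOn_finite_ncard (S := S) (α := α) hgfin
  have hS : 0 < Nat.card S := Nat.card_pos_iff.2 ⟨⟨Blank.blank⟩, inferInstance⟩
  -- The exponent is polynomial in `i`, as `L` is fixed, against the lower bound exponential in `i`
  -- on the logarithm.
  have h1 : F.ncard ≤ Nat.card S ^ (N + i * K + 1) ^ L.length :=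
    (Set.ncard_le_ncard hFV hwfin).trans (hwcard.trans (Nat.pow_le_pow_right hS hgcard))
  refine hlog.trans ?_
  have h2 := Real.log_le_log (by exact_mod_cast (by omega : 0 < F.ncard))
    (show (F.ncard : ℝ) ≤ ((Nat.card S ^ (N + i * K + 1) ^ L.length : ℕ) : ℝ) by exact_mod_cast h1)
  rwa [Nat.cast_pow, Real.log_pow, Nat.cast_pow, Nat.cast_add, Nat.cast_add, Nat.cast_mul,
    Nat.cast_one] at h2
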